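/- **Setting.** Let $\mathcal C$ be a countably infinite set of values. A *DCDS* $\mathcal S$ over $\mathcal C$ consists of a finite relational schema $\mathcal R$, a finite initial database $\mathcal I_0$ over $\mathcal R$ with values in $\mathcal C$, a finite set $\mathcal E$ of equality constraints $Q\to\bigwedge_j z_j=y_j$ ($Q$ a first-order query, $z_j,y_j$ free variables of $Q$ or constants) satisfied by $\mathcal I_0$, a finite set of service names with arities, finitely many actions with parameters, each with finitely many effects $q^+\wedge Q^-\rightsquigarrow E$ ($q^+$ a union of conjunctive queries, $Q^-$ a first-order formula, $E$ a finite set of facts whose terms are constants, parameters, free variables of $q^+$, or a service name applied to such terms), and finitely many rules $Q\mapsto\alpha$ ($Q$ a first-order query whose free variables are the parameters of $\alpha$). All constants used belong to the active domain $\mathrm{adom}(\mathcal I_0)$. Answers to a query over $\mathcal I$ assign values in $\mathrm{adom}(\mathcal I)$ to its free variables. For a database $\mathcal I$ and an action $\alpha$, a parameter assignment $\sigma$ is *legal* if it answers $Q$ over $\mathcal I$ for some rule $Q\mapsto\alpha$. $\mathrm{do}(\mathcal I,\alpha,\sigma)$ is the union of the facts $E\sigma\theta$ over all effects of $\alpha$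 and all answers $\theta$ to $(q^+\wedge Q^-)\sigma$ over $\mathcal I$; $\mathrm{calls}(\mathcal I,\alpha,\sigma)$ is the set of service calls $f(c_1,\dots,c_n)$ occurring in it. An *evaluation* is a function $\theta:\mathrm{calls}(\mathcal I,\alpha,\sigma)\to\mathcal C$; it yields the database $\mathrm{do}(\mathcal I,\alpha,\sigma)\theta$. There is a concrete transition $\mathcal I\Rightarrow\mathcal I'$ if $\mathcal I'=\mathrm{do}(\mathcal I,\alpha,\sigma)\theta$ satisfies $\mathcal E$ for some action $\alpha$, legal $\sigma$ and evaluation $\theta$ (services are nondeterministic). The *concrete transition system* $\Upsilon_{\mathcal S}$ has as states all databases reachable from $\mathcal I_0$. $\mathcal S$ is *state-bounded* if there is a finite $b$ with $|\mathrm{adom}(\mathcal I)|<b$ for all states $\mathcal I$ of $\Upsilon_{\mathcal S}$. An *equality commitment* $H$ for $(\mathcal I,\alpha,\sigma)$ is a partition of $D=\mathrm{calls}(\mathcal I,\alpha,\sigma)\cup\mathrm{adom}(\mathcal I)\cup\mathrm{adom}(\mathcal I_0)$ whose cells contain at most one value each; $\mathrm{evals}^H(\mathcal I,\alpha,\sigma)$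 is the set of evaluations $\theta$ such that $t_1\theta=t_2\theta$ iff $t_1,t_2$ are in the same cell (for all $t_1,t_2\in D$), and $\mathrm{do}(\mathcal I,\alpha,\sigma)\theta$ satisfies $\mathcal E$. A *pruning* of $\Upsilon_{\mathcal S}$ is a transition system with initial state $\mathcal I_0$ whose states and transitions are among those of $\Upsilon_{\mathcal S}$, in which each state has finitely many successors, and such that for each of its states $\mathcal I$, each $\alpha$, each legal $\sigma$ and each $H$ with $\mathrm{evals}^H(\mathcal I,\alpha,\sigma)\neq\emptyset$ it has a transition from $\mathcal I$ to $\mathrm{do}(\mathcal I,\alpha,\sigma)\theta$ for some $\theta\in\mathrm{evals}^H(\mathcal I,\alpha,\sigma)$. It is *eventually recycling* if on every path $s_0s_1\cdots$ in it, with $s_k\Rightarrow s_{k+1}$ generated by the evaluation $\theta_k$, there are only finitely many $k$ such that some value of $\theta_k$ does not occur in $s_0,\dots,s_k$. Two such transition systems are *persistence-preserving bisimilar* ($\sim$) if there is a relation $B$ of triples $(s_1,h,s_2)$, with $h$ a partial bijection of $\mathcal C$, that relates the initial states by some $h$, and such that $(s_1,h,s_2)\in B$ implies: $h$ is defined and the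 identity on $\mathrm{adom}(\mathcal I_0)$; $h$ induces an isomorphism from $s_1$ to $s_2$; for every $s_1\Rightarrow s_1'$ there are $s_2\Rightarrow s_2'$ and $h'$ with $(s_1',h',s_2')\in B$ such that $h'$ extends $h|_{\mathrm{adom}(s_1)\cap\mathrm{adom}(s_1')}$ and $h'^{-1}$ extends $h^{-1}|_{\mathrm{adom}(s_2)\cap\mathrm{adom}(s_2')}$; and symmetrically for every $s_2\Rightarrow s_2'$. **Algorithm Rcycl** on input $\mathcal S$. Start with $\Sigma=\{\mathcal I_0\}$, ${\Longrightarrow}=\emptyset$, $\mathit{Used}=\mathrm{adom}(\mathcal I_0)$, $\mathit{Visited}=\emptyset$. Repeat: pick $\mathcal I\in\Sigma$, an action $\alpha$ and a legal $\sigma$ with $(\mathcal I,\alpha,\sigma)\notin\mathit{Visited}$. Let $\mathit{Rec}=\mathit{Used}\setminus(\mathrm{adom}(\mathcal I_0)\cup\mathrm{adom}(\mathcal I))$ and $n=|\mathrm{calls}(\mathcal I,\alpha,\sigma)|$. Pick a set $V$ of $n$ values with $V\subseteq\mathit{Rec}$ if $|\mathit{Rec}|\ge n$, and $V\subseteq\mathcal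 C\setminus\mathit{Used}$ otherwise. For each evaluation $\theta$ with values in $\mathrm{adom}(\mathcal I_0)\cup\mathrm{adom}(\mathcal I)\cup V$ such that $\mathcal I'=\mathrm{do}(\mathcal I,\alpha,\sigma)\theta$ satisfies $\mathcal E$: add $\mathcal I'$ to $\Sigma$, $(\mathcal I,\mathcal I')$ to $\Longrightarrow$, and $\mathrm{adom}(\mathcal I')$ to $\mathit{Used}$. Then add $(\mathcal I,\alpha,\sigma)$ to $\mathit{Visited}$. Stop when $\Sigma$ and $\Longrightarrow$ no longer change, i.e. when no further sequence of iterations can change them (in particular when nothing can be picked), and return $(\Sigma,\mathcal I_0,\Longrightarrow)$. **Theorem.** If $\mathcal S$ is state-bounded, then every run of Rcycl terminates, whatever nondeterministic choices are made: each iteration can be carried out and runs through finitely many evaluations, and no run performs infinitely many iterations. Moreover, the transition system that any run returns is finite, is an eventually recycling pruning of $\Upsilon_{\mathcal S}$, and is persistence-preserving bisimilar to $\Upsilon_{\mathcal S}$. -/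

import Mathlib

universe u v w

/-! ### Databases and queries -/

namespace Dcds

/-- A finite set of symbols with arities: a database schema (the symbols are relation names), or the
interfaces of the external services (the symbols are function names). -/
structure Signature where
  Sym : Type
  finite_sym : Finite Sym
  arity : Sym → ℕ

/-- A fact `R(t₁,…,tₙ)` over the schema `R` with terms from `T`. -/
structure Fact (R : Signature) (T : Type u) where
  rel : R.Sym
  args : Fin (R.arity rel) → T

/-- Replace all terms of a fact. -/
def Fact.map {R : Signature} {T : Type u} {T' : Type v} (g : T → T') (f : Fact R T) : Fact R T' :=
  ⟨f.rel, fun i => g (f.args i)⟩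

/-- A set of facts over the schema `R` with terms from `T`. (All sets of facts that occur below as
states are finite, because the initial one is.) -/
abbrev Database (R : Signature) (T : Type u) : Type u := Set (Fact R T)

/-- The active domain: the terms that occur in a database. -/
def adom {R : Signature} {T : Type u} (I : Database R T) : Set T :=
  {t | ∃ f ∈ I, ∃ i, f.args i = t}

/-- The first-order language whose relation symbols are the relations of the schema `R` and whose
constants are the elements of `K` (there are no other function symbols). -/
def queryLang {C : Type u} (R : Signature) (K : Set C) : FirstOrder.Language.{u, 0} where
  Functions n := match n with
    | 0 => K
    | _ + 1 => PEmpty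
  Relations n := {r : R.Sym // R.arity r = n}

/-- A database as a first-order structure with universe `C`; constants denote themselves. -/
@[reducible]
def dbStructure {C : Type u} {R : Signature} (K : Set C) (I : Database R C) :
    (queryLang R K).Structure C where
  funMap {n} := match n with
    | 0 => fun k _ => Subtype.val (p := fun c => c ∈ K) k
    | _ + 1 => fun k _ => PEmpty.elim k
  RelMap r x := (⟨r.1, fun i => x (Fin.cast r.2 i)⟩ : Fact R C) ∈ I

/-- First-order queries over the schema `R`, with constants in `K` and free variables in `α`. -/
abbrev Query {C : Type u} (R : Signature) (K : Set C) (α : Type) : Type u :=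
  (queryLang R K).Formula α

/-- `I ⊨ Qθ`. -/
def Models {C : Type u} {R : Signature} {K : Set C} {α : Type} (I : Database R C) (Q : Query R K α)
    (θ : α → C) : Prop :=
  letI := dbStructure K I
  Q.Realize θ

/-- `ans(Q, I)`: the assignments of the free variables to the active domain of `I` that satisfy `Q`
in `I`. -/
def ans {C : Type u} {R : Signature} {K : Set C} {α : Type} (Q : Query R K α) (I : Database R C) :
    Set (α → C) :=
  {θ | (∀ x, θ x ∈ adom I) ∧ Models I Q θ}

/-- Conjunctive queries: built from atoms by conjunction and existential quantification. -/
inductive IsCQ {L : FirstOrder.Language.{u, v}} {α : Type w} : ∀ {n : ℕ}, L.BoundedFormula α n → Prop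
  | top {n : ℕ} : IsCQ (⊤ : L.BoundedFormula α n)
  | rel {n l : ℕ} (r : L.Relations l) (ts : Fin l → L.Term (α ⊕ Fin n)) : IsCQ (r.boundedFormula ts)
  | equal {n : ℕ} (s t : L.Term (α ⊕ Fin n)) : IsCQ (s.bdEqual t)
  | inf {n : ℕ} {φ ψ : L.BoundedFormula α n} : IsCQ φ → IsCQ ψ → IsCQ (φ ⊓ ψ)
  | ex {n : ℕ} {φ : L.BoundedFormula α (n + 1)} : IsCQ φ → IsCQ φ.ex

/-- Unions of conjunctive queries. -/
inductive IsUCQ {L : FirstOrder.Language.{u, v}} {α : Type w} : L.Formula α → Prop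
  | bot : IsUCQ (⊥ : L.Formula α)
  | cq {φ : L.Formula α} : IsCQ φ → IsUCQ φ
  | sup {φ ψ : L.Formula α} : IsUCQ φ → IsUCQ ψ → IsUCQ (φ ⊔ ψ)

/-! ### Data layer -/

/-- An equality constraint `Q → ⋀ⱼ zⱼ = yⱼ`, where every `zⱼ`, `yⱼ` is a free variable of `Q` or a
constant in `K`. -/
structure EqConstraint {C : Type u} (R : Signature) (K : Set C) where
  nvars : ℕ
  query : Query R K (Fin nvars)
  eqs : List ((Fin nvars ⊕ K) × (Fin nvars ⊕ K))

/-- The database `I` satisfies an equality constraint. -/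
def EqConstraint.Sat {C : Type u} {R : Signature} {K : Set C} (e : EqConstraint R K)
    (I : Database R C) : Prop :=
  ∀ θ ∈ ans e.query I, ∀ p ∈ e.eqs,
    Sum.elim θ Subtype.val p.1 = Sum.elim θ Subtype.val p.2

/-- A data layer with set of values `C`. All constants in queries come from `adom init`. -/
structure DataLayer (C : Type u) where
  schema : Signature
  init : Database schema C
  finite_init : init.Finite
  constraints : List (EqConstraint schema (adom init))
  init_sat : ∀ e ∈ constraints, e.Sat init

/-! ### Process layer -/

/-- A term `f(t₁,…,tₙ)`, with `f` an external service: a service call when the `tᵢ` are values. -/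
structure Call (F : Signature) (T : Type u) where
  fn : F.Sym
  args : Fin (F.arity fn) → T

def Call.map {F : Signature} {T : Type u} {T' : Type v} (g : T → T') (s : Call F T) : Call F T' :=
  ⟨s.fn, fun i => g (s.args i)⟩

/-- Terms that are either basic, or one service applied to basic terms. -/
abbrev SkTerm (F : Signature) (T : Type u) : Type u := T ⊕ Call F T

def SkTerm.map {F : Signature} {T : Type u} {T' : Type v} (g : T → T') :
    SkTerm F T → SkTerm F T' :=
  Sum.map g (Call.map g)

/-- The basic terms of an effect: constants in `K`, `m` action parameters, and `n` variables. -/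
abbrev BaseTerm {C : Type u} (K : Set C) (m n : ℕ) : Type u := K ⊕ (Fin m ⊕ Fin n)

/-- An effect specification `q⁺ ∧ Q⁻ ⇝ E` of an action with `m` parameters; `q⁺` is a UCQ with
`nvars` free variables. -/
structure Effect {C : Type u} (R : Signature) (K : Set C) (F : Signature) (m : ℕ) where
  nvars : ℕ
  pos : Query R K (Fin m ⊕ Fin nvars)
  pos_ucq : IsUCQ pos
  neg : Query R K (Fin m ⊕ Fin nvars)
  head : List (Fact R (SkTerm F (BaseTerm K m nvars)))

/-- A process layer over a data layer: services, finitely many actions with their parameters and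
effect specifications, and condition-action rules `Q ↦ α`. -/
structure ProcessLayer {C : Type u} (D : DataLayer C) where
  services : Signature
  Action : Type
  finite_action : Finite Action
  nparams : Action → ℕ
  effects : ∀ α : Action, List (Effect D.schema (adom D.init) services (nparams α))
  rules : List (Σ α : Action, Query D.schema (adom D.init) (Fin (nparams α)))

/-- A relational data-centric dynamic system over the set of values `C`. -/
structure DCDS (C : Type u) where
  data : DataLayer C
  process : ProcessLayer data

/-! ### Transition systems and persistence-preserving bisimilarity -/

/-- Transition systems over the values `C` and the schema `R`. -/
structure TransitionSystem (C : Type u) (R : Signature) where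
  State : Type u
  init : State
  db : State → Database R C
  step : State → State → Prop

/-- The partial bijection `h` is defined on `adom I`, and restricts to an isomorphism from `I`
to `J`. -/
def IsIso {C : Type u} {R : Signature} (h : C ≃. C) (I J : Database R C) : Prop :=
  (∀ a ∈ adom I, ∃ b ∈ adom J, b ∈ h a) ∧ (∀ b ∈ adom J, ∃ a ∈ adom I, b ∈ h a) ∧
    ∀ (r : R.Sym) (x y : Fin (R.arity r) → C), (∀ i, y i ∈ h (x i)) →
      ((⟨r, x⟩ : Fact R C) ∈ I ↔ (⟨r, y⟩ : Fact R C) ∈ J)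

/-- `h'` extends the restriction of `h` to the values that persist from `I` to `I'`, and `h'⁻¹`
extends the restriction of `h⁻¹` to the values that persist from `J` to `J'`. -/
def Persists {C : Type u} {R : Signature} (h h' : C ≃. C) (I I' J J' : Database R C) : Prop :=
  (∀ a ∈ adom I ∩ adom I', h' a = h a) ∧ (∀ b ∈ adom J ∩ adom J', h'.symm b = h.symm b)

/-- Persistence-preserving bisimulations through partial bijections that are the identity on the
set `K` of distinguished constants. -/
def IsPersistenceBisimulation {C : Type u} {R : Signature} (K : Set C)
    (T₁ T₂ : TransitionSystem C R) (B : T₁.State → (C ≃. C) → T₂.State → Prop) : Prop :=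
  ∀ s₁ h s₂, B s₁ h s₂ →
    (∀ c ∈ K, c ∈ h c) ∧ IsIso h (T₁.db s₁) (T₂.db s₂) ∧
    (∀ s₁', T₁.step s₁ s₁' → ∃ s₂' h', T₂.step s₂ s₂' ∧
      Persists h h' (T₁.db s₁) (T₁.db s₁') (T₂.db s₂) (T₂.db s₂') ∧ B s₁' h' s₂') ∧
    (∀ s₂', T₂.step s₂ s₂' → ∃ s₁' h', T₁.step s₁ s₁' ∧
      Persists h h' (T₁.db s₁) (T₁.db s₁') (T₂.db s₂) (T₂.db s₂') ∧ B s₁' h' s₂')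

/-- `T₁ ∼ T₂`: persistence-preserving bisimilarity of transition systems. -/
def PersistenceBisimilar {C : Type u} {R : Signature} (K : Set C)
    (T₁ T₂ : TransitionSystem C R) : Prop :=
  ∃ B, IsPersistenceBisimulation K T₁ T₂ B ∧ ∃ h, B T₁.init h T₂.init

/-! ### Semantics with nondeterministic services -/

namespace DCDS

variable {C : Type u}

/-- Databases over the schema of `S` with values in `C`; the states of `S` are such databases. -/
abbrev DB (S : DCDS C) : Type u := Database S.data.schema C

/-- The initial state `I₀`. -/
abbrev init (S : DCDS C) : S.DB := S.data.init

abbrev Action (S : DCDS C) : Type := S.process.Action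

/-- Substitutions of values for the parameters of the action `α`. -/
abbrev Params (S : DCDS C) (α : S.Action) : Type u := Fin (S.process.nparams α) → C

/-- Ground service calls `f(v₁,…,vₙ)`. -/
abbrev GCall (S : DCDS C) : Type u := Call S.process.services C

/-- `I` satisfies the equality constraints. -/
def Conforms (S : DCDS C) (I : S.DB) : Prop :=
  ∀ e ∈ S.data.constraints, e.Sat I

/-- `σ` is legal for `α` in `I`: it answers the condition of some rule `Q ↦ α`. -/
def Legal (S : DCDS C) (I : S.DB) (α : S.Action) (σ : S.Params α) : Prop :=
  ∃ Q, (⟨α, Q⟩ : Σ α : S.Action, Query S.data.schema (adom S.init) (Fin (S.process.nparams α)))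
    ∈ S.process.rules ∧ σ ∈ ans Q I

/-- `do(I, α, σ)`: the union, over the effect specifications `q⁺ ∧ Q⁻ ⇝ E` of `α` and the answers
`θ` to `(q⁺ ∧ Q⁻)σ` over `I`, of the facts `Eσθ`. -/
def doo (S : DCDS C) (I : S.DB) (α : S.Action) (σ : S.Params α) :
    Database S.data.schema (SkTerm S.process.services C) :=
  {g | ∃ e ∈ S.process.effects α, ∃ θ : Fin e.nvars → C,
    (∀ x, θ x ∈ adom I) ∧ Models I (e.pos ⊓ e.neg) (Sum.elim σ θ) ∧
    ∃ f ∈ e.head, g = f.map (SkTerm.map (Sum.elim Subtype.val (Sum.elim σ θ)))}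

/-- The service calls that occur in `do(I, α, σ)`. -/
def calls (S : DCDS C) (I : S.DB) (α : S.Action) (σ : S.Params α) : Set S.GCall :=
  {s | Sum.inr s ∈ adom (S.doo I α σ)}

/-- Evaluations: total functions from the service calls in `do(I, α, σ)` to values. -/
abbrev Eval (S : DCDS C) (I : S.DB) (α : S.Action) (σ : S.Params α) : Type u :=
  S.calls I α σ → C

/-- The value `tθ` of a term all of whose service calls are evaluated by `θ`. -/
def termVal {S : DCDS C} {I : S.DB} {α : S.Action} {σ : S.Params α} (θ : S.Eval I α σ) :
    (t : SkTerm S.process.services C) → (∀ s, t = Sum.inr s → s ∈ S.calls I α σ) → C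
  | Sum.inl c, _ => c
  | Sum.inr s, h => θ ⟨s, h s rfl⟩

/-- The database `do(I, α, σ)θ`. -/
def next {S : DCDS C} {I : S.DB} {α : S.Action} {σ : S.Params α} (θ : S.Eval I α σ) : S.DB :=
  {g | ∃ (f : _) (hf : f ∈ S.doo I α σ),
    g = ⟨f.rel, fun i => termVal θ (f.args i) fun _ hs => ⟨f, hf, i, hs⟩⟩}

/-- Concrete execution of `ασθ`, leading from `I` to `J`. -/
def Exec (S : DCDS C) (I : S.DB) (α : S.Action) (σ : S.Params α) (θ : S.Eval I α σ) (J : S.DB) :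
    Prop :=
  S.Legal I α σ ∧ J = next θ ∧ S.Conforms J

/-- There is a concrete execution from `I` to `J`. -/
def Step (S : DCDS C) (I J : S.DB) : Prop :=
  ∃ α σ θ, S.Exec I α σ θ J

/-- The states of the concrete transition system. -/
def concreteStates (S : DCDS C) : Set S.DB :=
  {I | Relation.ReflTransGen S.Step S.init I}

/-- The transition system with initial state `I₀`, with the given set of databases as states (each
labelled by itself), and the given transitions. -/
def mkTS (S : DCDS C) (Sta : Set S.DB) (h : S.init ∈ Sta) (tr : Set (S.DB × S.DB)) :
    TransitionSystem C S.data.schema where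
  State := Sta
  init := ⟨S.init, h⟩
  db s := s.1
  step s t := (s.1, t.1) ∈ tr

/-- The concrete transition system of `S`. -/
def concreteTS (S : DCDS C) : TransitionSystem C S.data.schema :=
  S.mkTS S.concreteStates Relation.ReflTransGen.refl {p | S.Step p.1 p.2}

/-- `S` is state-bounded. -/
def StateBounded (S : DCDS C) : Prop :=
  ∃ b : ℕ, ∀ I ∈ S.concreteStates, (adom I).encard < b

/-! ### Equality commitments, prunings, recycling -/

/-- The service calls in `do(I, α, σ)` together with the values in `adom(I) ∪ adom(I₀)`. -/
def commitDomain (S : DCDS C) (I : S.DB) (α : S.Action) (σ : S.Params α) :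
    Set (SkTerm S.process.services C) :=
  {t | (∃ c ∈ adom I ∪ adom S.init, t = Sum.inl c) ∨ ∃ s ∈ S.calls I α σ, t = Sum.inr s}

/-- An equality commitment: a partition (given by its equivalence relation) of the above set, each
cell of which contains at most one constant. -/
structure Commitment (S : DCDS C) (I : S.DB) (α : S.Action) (σ : S.Params α) where
  rel : Setoid (S.commitDomain I α σ)
  const_eq : ∀ t t' : S.commitDomain I α σ, ∀ c c' : C,
    t.1 = Sum.inl c → t'.1 = Sum.inl c' → rel t t' → c = c'

/-- Terms in the domain of commitments only have service calls that occur in `do(I, α, σ)`. -/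
theorem mem_calls_of_mem_commitDomain {S : DCDS C} {I : S.DB} {α : S.Action} {σ : S.Params α}
    {t : SkTerm S.process.services C} (ht : t ∈ S.commitDomain I α σ) (s : S.GCall)
    (hs : t = Sum.inr s) : s ∈ S.calls I α σ := by
  subst hs
  rcases ht with ⟨c, _, hc⟩ | ⟨s', hs', h⟩
  · cases hc
  · cases h
    exact hs'

/-- `θ` respects `H`: two terms are in the same cell iff `θ` gives them the same value. -/
def Respects {S : DCDS C} {I : S.DB} {α : S.Action} {σ : S.Params α} (θ : S.Eval I α σ)
    (H : S.Commitment I α σ) : Prop :=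
  ∀ t t' : S.commitDomain I α σ, H.rel t t' ↔
    termVal θ t.1 (mem_calls_of_mem_commitDomain t.2) =
      termVal θ t'.1 (mem_calls_of_mem_commitDomain t'.2)

/-- The evaluations that respect `H` and lead to a database satisfying the constraints. -/
def evals (S : DCDS C) (I : S.DB) (α : S.Action) (σ : S.Params α) (H : S.Commitment I α σ) :
    Set (S.Eval I α σ) :=
  {θ | Respects θ H ∧ S.Conforms (next θ)}

/-- The states `Sta` and transitions `tr` form a pruning of the concrete transition system: a
subsystem that contains the initial state, is finitely branching, and in which each of its states
still has, for every legal `α`, `σ` and every equality commitment `H` represented by a concrete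
successor of that state via `α`, `σ`, a successor that represents `H` via `α`, `σ`. -/
structure IsPruning (S : DCDS C) (Sta : Set S.DB) (tr : Set (S.DB × S.DB)) : Prop where
  init_mem : S.init ∈ Sta
  states_subset : Sta ⊆ S.concreteStates
  trans_subset : ∀ I J, (I, J) ∈ tr → I ∈ Sta ∧ J ∈ Sta ∧ S.Step I J
  represented : ∀ I ∈ Sta, ∀ (α : S.Action) (σ : S.Params α), S.Legal I α σ →
    ∀ H : S.Commitment I α σ, (S.evals I α σ H).Nonempty →
      ∃ θ ∈ S.evals I α σ H, (I, next θ) ∈ tr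
  finite_branching : ∀ I ∈ Sta, {J | (I, J) ∈ tr}.Finite

/-- On every infinite path `s₀ s₁ …` with transitions in `tr`, whose `k`-th step is generated by the
evaluation `θₖ`, there are only finitely many `k` such that `θₖ` does not recycle, that is, takes a
value that does not occur in `s₀, …, sₖ`. (For finite paths there is nothing to say.) -/
def EventuallyRecycling (S : DCDS C) (tr : Set (S.DB × S.DB)) : Prop :=
  ∀ (s : ℕ → S.DB) (α : ℕ → S.Action) (σ : ∀ k, S.Params (α k))
    (θ : ∀ k, S.Eval (s k) (α k) (σ k)),
    (∀ k, (s k, s (k + 1)) ∈ tr ∧ S.Exec (s k) (α k) (σ k) (θ k) (s (k + 1))) →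
    {k | ¬ ∀ c, θ k c ∈ ⋃ j ≤ k, adom (s j)}.Finite

/-! ### Algorithm Rcycl -/

/-- The values of the program variables `Σ`, `⟹`, `UsedValues` and `Visited`. -/
structure Config (S : DCDS C) where
  states : Set S.DB
  trans : Set (S.DB × S.DB)
  used : Set C
  visited : Set (S.DB × Σ α : S.Action, S.Params α)

/-- The initialization of the algorithm. -/
def initConfig (S : DCDS C) : S.Config where
  states := {S.init}
  trans := ∅
  used := adom S.init
  visited := ∅

/-- The body of the inner loop, for the state `I` and its successor `J`. -/
def Config.record {S : DCDS C} (I : S.DB) (c : S.Config) (J : S.DB) : S.Config where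
  states := insert J c.states
  trans := insert (I, J) c.trans
  used := c.used ∪ adom J
  visited := c.visited

/-- `(I, α, σ)` may be picked in the configuration `c`. -/
def Pickable {S : DCDS C} (c : S.Config) (I : S.DB) (α : S.Action) (σ : S.Params α) : Prop :=
  I ∈ c.states ∧ S.Legal I α σ ∧ (I, ⟨α, σ⟩) ∉ c.visited

/-- `RecyclableValues`. -/
def recyclable {S : DCDS C} (c : S.Config) (I : S.DB) : Set C :=
  c.used \ (adom S.init ∪ adom I)

open Classical in
/-- `V` may be picked as the set of service call results: it has as many elements as there are
service calls, and it consists of recyclable values if there are enough of them, and of fresh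
values otherwise. -/
def Admissible {S : DCDS C} (c : S.Config) (I : S.DB) (α : S.Action) (σ : S.Params α) (V : Set C) :
    Prop :=
  V.encard = (S.calls I α σ).encard ∧
    if (S.calls I α σ).encard ≤ (recyclable c I).encard then V ⊆ recyclable c I else V ⊆ c.usedᶜ

/-- The evaluations through which the inner loop runs: those with values in
`F = adom(I₀) ∪ adom(I) ∪ V` whose result satisfies the constraints. -/
def loopEvals (S : DCDS C) (I : S.DB) (α : S.Action) (σ : S.Params α) (V : Set C) :
    Set (S.Eval I α σ) :=
  {θ | (∀ s, θ s ∈ adom S.init ∪ adom I ∪ V) ∧ S.Conforms (next θ)}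

/-- One iteration of the outer loop, with all its nondeterministic choices: the picked triple
`(I, α, σ)`, the picked set `V`, and the order `L` in which the inner loop runs through its
evaluations. -/
def Iteration (S : DCDS C) (c c' : S.Config) : Prop :=
  ∃ (I : S.DB) (α : S.Action) (σ : S.Params α) (V : Set C) (L : List (S.Eval I α σ)),
    Pickable c I α σ ∧ Admissible c I α σ V ∧ L.Nodup ∧ (∀ θ, θ ∈ L ↔ θ ∈ S.loopEvals I α σ V) ∧
    c' = { L.foldl (fun d θ => d.record I (next θ)) c with
      visited := insert (I, ⟨α, σ⟩) c.visited }

/-- `c` is reached by finitely many iterations of the algorithm. -/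
def Reached (S : DCDS C) (c : S.Config) : Prop :=
  Relation.ReflTransGen S.Iteration S.initConfig c

/-- The exit condition of the outer loop: `Σ` and `⟹` no longer change, whatever is picked. (This
holds in particular when no triple can be picked any more.) -/
def Saturated (S : DCDS C) (c : S.Config) : Prop :=
  ∀ c', Relation.ReflTransGen S.Iteration c c' → c'.states = c.states ∧ c'.trans = c.trans

end DCDS

end Dcds

namespace Dcds

/-! The dynamics cannot tell values outside `adom S.init` apart. A permutation of `C` that fixes
these constants is an isomorphism of first-order structures, so it preserves answers, legality,
`doo`, evaluations (after conjugation) and constraints (`models_map`, `doo_map`, `next_map`,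
`step_map`). Hence the outcome of an action depends, up to a permutation fixing `adom I` and the
constants, only on the equality commitment of the evaluation (`exists_perm_next`). Any pruning is
therefore bisimilar to the concrete system, by relating two databases whenever such a permutation
carries one to the other (`IsPruning.persistenceBisimilar`).

State-boundedness bounds the number of service calls in reachable states by some `M`. The algorithm
takes fresh values only when fewer than `M` used values are recyclable; all other used values lie in
the initial or the current database. So the number of used values never exceeds a fixed `U`
(`exists_invariant`). Along a run all used values lie in one finite set, over which there are
finitely many triples to visit, and each iteration visits a new one (`not_exists_infinite_run`).

Once nothing can be picked, every legal triple has been processed with a set `V` large enough, and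
disjoint enough, to realize every commitment, so the output is a pruning
(`Config.Invariant.isPruning`). It recycles eventually because its paths use finitely many values.
-/

/-- The equality pattern makes `x i ↦ y i` a well-defined injection on a finite set. A permutation
of all of `C` is wanted, not a partial bijection, because quantifiers in queries range over `C`. -/
theorem exists_perm_of_injective_pattern {C : Type u} {ι : Type v} [Finite ι] (x y : ι → C)
    (h : ∀ i j, x i = x j ↔ y i = y j) : ∃ π : Equiv.Perm C, ∀ i, π (x i) = y i := by
  choose j hj using fun a : Set.range x => a.2
  obtain ⟨π, hπ⟩ := Equiv.Perm.exists_extending_pair (fun a : Set.range x => a.1)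
    (fun a => y (j a)) Subtype.val_injective fun a b hab => Subtype.ext <| by
      rw [← hj a, ← hj b]
      exact (h _ _).2 hab
  exact ⟨π, fun i => (hπ ⟨x i, i, rfl⟩).trans ((h _ _).1 (hj _))⟩

/-- A map that is injective on a finite set agrees on that set with a permutation. -/
theorem _root_.Set.InjOn.exists_perm {C : Type u} {A : Set C} (hA : A.Finite) {f : C → C}
    (hf : A.InjOn f) : ∃ π : Equiv.Perm C, ∀ a ∈ A, π a = f a := by
  have := hA.to_subtype
  obtain ⟨π, hπ⟩ := exists_perm_of_injective_pattern (fun a : A => a.1) (fun a => f a.1)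
    fun a b => ⟨fun h => by rw [h], fun h => hf a.2 b.2 h⟩
  exact ⟨π, fun a ha => hπ ⟨a, ha⟩⟩

/-! ### Facts and databases -/

theorem Fact.map_map {R : Signature} {T : Type u} {T' : Type v} {T'' : Type w} (g : T' → T'')
    (f : T → T') (x : Fact R T) : (x.map f).map g = x.map (g ∘ f) := rfl

theorem Fact.map_injective {R : Signature} {T : Type u} {T' : Type v} {g : T → T'}
    (hg : Function.Injective g) : Function.Injective (Fact.map (R := R) g) := by
  rintro ⟨r, x⟩ ⟨r', y⟩ h
  simp only [Fact.map, Fact.mk.injEq] at h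
  obtain ⟨rfl, h⟩ := h
  have : x = y := funext fun i => hg (congrFun (eq_of_heq h) i)
  rw [this]

theorem Fact.map_congr {R : Signature} {T : Type u} {T' : Type v} {f g : T → T'} {x : Fact R T}
    (h : ∀ i, f (x.args i) = g (x.args i)) : x.map f = x.map g := by
  simp [Fact.map, h]

/-- Replace all terms of a database. -/
def Database.map {R : Signature} {T : Type u} {T' : Type v} (g : T → T') (I : Database R T) :
    Database R T' :=
  Fact.map g '' I

theorem Database.map_map {R : Signature} {T : Type u} {T' : Type v} {T'' : Type w} (g : T' → T'')
    (f : T → T') (I : Database R T) :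
    Database.map g (Database.map f I) = Database.map (g ∘ f) I := by
  simp only [Database.map, Set.image_image, Fact.map_map]

theorem Database.map_id {R : Signature} {T : Type u} (I : Database R T) :
    Database.map id I = I := by
  exact Set.image_id I

theorem Database.map_congr {R : Signature} {T : Type u} {T' : Type v} {f g : T → T'}
    {I : Database R T} (h : ∀ t ∈ adom I, f t = g t) : Database.map f I = Database.map g I :=
  Set.image_congr fun x hx => Fact.map_congr fun i => h _ ⟨x, hx, i, rfl⟩

theorem Database.map_symm_map {R : Signature} {C : Type u} (π : Equiv.Perm C)
    (I : Database R C) : Database.map π.symm (Database.map π I) = I := by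
  rw [Database.map_map, Equiv.symm_comp_self, Database.map_id]

theorem Database.map_map_symm {R : Signature} {C : Type u} (π : Equiv.Perm C)
    (I : Database R C) : Database.map π (Database.map π.symm I) = I := by
  rw [Database.map_map, Equiv.self_comp_symm, Database.map_id]

theorem adom_map {R : Signature} {T : Type u} {T' : Type v} (g : T → T') (I : Database R T) :
    adom (Database.map g I) = g '' adom I := by
  ext t
  constructor
  · rintro ⟨_, ⟨f, hf, rfl⟩, i, rfl⟩
    exact ⟨f.args i, ⟨f, hf, i, rfl⟩, rfl⟩
  · rintro ⟨_, ⟨f, hf, i, rfl⟩, rfl⟩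
    exact ⟨_, ⟨f, hf, rfl⟩, i, rfl⟩

theorem adom_finite {R : Signature} {T : Type u} {I : Database R T} (h : I.Finite) :
    (adom I).Finite := by
  have : adom I = ⋃ f ∈ I, Set.range f.args := by
    ext t; simp [adom]
  rw [this]
  exact h.biUnion fun f _ => Set.finite_range _

theorem finite_facts (R : Signature) {T : Type u} {A : Set T} (hA : A.Finite) :
    {f : Fact R T | ∀ i, f.args i ∈ A}.Finite := by
  have := R.finite_sym
  have : {f : Fact R T | ∀ i, f.args i ∈ A} =
      ⋃ r : R.Sym, Fact.mk r '' {x | ∀ i, x i ∈ A} := by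
    ext ⟨r, x⟩
    simp only [Set.mem_ofPred_eq, Set.mem_iUnion, Set.mem_image, Fact.mk.injEq]
    constructor
    · intro h
      exact ⟨r, x, h, rfl, HEq.rfl⟩
    · rintro ⟨r, x, h, rfl, hx⟩
      cases hx
      exact h
  rw [this]
  exact Set.finite_iUnion fun r => (Set.Finite.pi' fun _ => hA).image _

theorem finite_databases (R : Signature) {T : Type u} {A : Set T} (hA : A.Finite) :
    {I : Database R T | adom I ⊆ A}.Finite :=
  (finite_facts R hA).finite_subsets.subset fun _ hI f hf i => hI ⟨f, hf, i, rfl⟩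

theorem isIso_map {R : Signature} {C : Type u} (π : Equiv.Perm C) (I : Database R C) :
    IsIso π.toPEquiv I (Database.map π I) := by
  refine ⟨fun a ha => ⟨π a, ?_, rfl⟩, fun b hb => ?_, fun r x y hxy => ?_⟩
  · rw [adom_map]
    exact ⟨a, ha, rfl⟩
  · rw [adom_map] at hb
    obtain ⟨a, ha, rfl⟩ := hb
    exact ⟨a, ha, rfl⟩
  · have : y = fun i => π (x i) := funext fun i => (Option.some.inj (hxy i)).symm
    subst this
    exact ((Fact.map_injective π.injective).mem_set_image (a := ⟨r, x⟩)).symm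

/-! ### Queries are invariant under permutations -/

/-- `π` is an isomorphism between the two structures on `C`; constants denote themselves, hence the
condition on `K`. -/
theorem models_map {C : Type u} {R : Signature} {K : Set C} {α : Type} {π : Equiv.Perm C}
    (hπ : ∀ c ∈ K, π c = c) (I : Database R C) (Q : Query R K α) (θ : α → C) :
    Models (Database.map π I) Q (π ∘ θ) ↔ Models I Q θ := by
  let e : @FirstOrder.Language.Equiv (queryLang R K) C C (dbStructure K I)
      (dbStructure K (Database.map π I)) :=
    @FirstOrder.Language.Equiv.mk (queryLang R K) C C (dbStructure K I)
      (dbStructure K (Database.map π I)) π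
      (fun {n} f x => by
        match n, f with
        | 0, f => exact hπ _ f.2
        | _ + 1, f => exact PEmpty.elim f)
      (fun {n} r x => (Fact.map_injective π.injective).mem_set_image (s := I)
        (a := ⟨r.1, fun i => x (Fin.cast r.2 i)⟩))
  exact @FirstOrder.Language.StrongHomClass.realize_formula (L := queryLang R K) (M := C) (N := C)
    (dbStructure K I) (dbStructure K (Database.map π I)) α _ _
    (@FirstOrder.Language.Equiv.instStrongHomClass (queryLang R K) C C (dbStructure K I)
      (dbStructure K (Database.map π I))) e Q θ

theorem mem_ans_map {C : Type u} {R : Signature} {K : Set C} {α : Type} {π : Equiv.Perm C}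
    (hπ : ∀ c ∈ K, π c = c) {I : Database R C} {Q : Query R K α} {θ : α → C}
    (h : θ ∈ ans Q I) : π ∘ θ ∈ ans Q (Database.map π I) := by
  refine ⟨fun x => ?_, (models_map hπ I Q θ).2 h.2⟩
  rw [adom_map]
  exact ⟨_, h.1 x, rfl⟩

theorem symm_fixes {C : Type u} {K : Set C} {π : Equiv.Perm C} (hπ : ∀ c ∈ K, π c = c) :
    ∀ c ∈ K, π.symm c = c :=
  fun c hc => (Equiv.symm_apply_eq π).2 (hπ c hc).symm

theorem EqConstraint.sat_map {C : Type u} {R : Signature} {K : Set C} {π : Equiv.Perm C}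
    (hπ : ∀ c ∈ K, π c = c) {I : Database R C} {e : EqConstraint R K} (h : e.Sat I) :
    e.Sat (Database.map π I) := by
  intro θ hθ p hp
  have h1 := mem_ans_map (symm_fixes hπ) hθ
  rw [Database.map_symm_map] at h1
  have h2 := h _ h1 p hp
  have h3 : ∀ t : Fin e.nvars ⊕ K,
      Sum.elim (π.symm ∘ θ) Subtype.val t = π.symm (Sum.elim θ Subtype.val t) := by
    rintro (x | c)
    · rfl
    · exact (symm_fixes hπ _ c.2).symm
  rw [h3, h3] at h2
  exact π.symm.injective h2

namespace DCDS

variable {C : Type u} (S : DCDS C)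

/-! ### Executions are invariant under permutations -/

theorem conforms_map {π : Equiv.Perm C} (hπ : ∀ c ∈ adom S.init, π c = c) {I : S.DB}
    (h : S.Conforms I) : S.Conforms (Database.map π I) :=
  fun e he => EqConstraint.sat_map hπ (h e he)

theorem legal_map {π : Equiv.Perm C} (hπ : ∀ c ∈ adom S.init, π c = c) {I : S.DB} {α : S.Action}
    {σ : S.Params α} (h : S.Legal I α σ) : S.Legal (Database.map π I) α (π ∘ σ) := by
  obtain ⟨Q, hQ, hσ⟩ := h
  exact ⟨Q, hQ, mem_ans_map hπ hσ⟩

theorem Legal.mem_adom {S : DCDS C} {I : S.DB} {α : S.Action} {σ : S.Params α}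
    (h : S.Legal I α σ) (i) : σ i ∈ adom I := by
  obtain ⟨Q, _, hσ⟩ := h
  exact hσ.1 i

theorem map_doo_subset {π : Equiv.Perm C} (hπ : ∀ c ∈ adom S.init, π c = c) (I : S.DB)
    (α : S.Action) (σ : S.Params α) :
    Database.map (SkTerm.map π) (S.doo I α σ) ⊆ S.doo (Database.map π I) α (π ∘ σ) := by
  rintro _ ⟨_, ⟨e, he, θ, hθ, hm, f, hf, rfl⟩, rfl⟩
  have h1 : Sum.elim (π ∘ σ) (π ∘ θ) = π ∘ Sum.elim σ θ := by
    ext (x | x) <;> rfl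
  refine ⟨e, he, π ∘ θ, fun x => ?_, ?_, f, hf, ?_⟩
  · rw [adom_map]
    exact ⟨_, hθ x, rfl⟩
  · rw [h1, models_map hπ]
    exact hm
  · have h2 : ∀ t : BaseTerm (adom S.init) (S.process.nparams α) e.nvars,
        π (Sum.elim Subtype.val (Sum.elim σ θ) t) =
          Sum.elim Subtype.val (Sum.elim (π ∘ σ) (π ∘ θ)) t := by
      rintro (c | t)
      · exact hπ _ c.2
      · rw [h1]; rfl
    rw [Fact.map_map]
    refine Fact.map_congr fun i => ?_
    rcases f.args i with t | ⟨g, ts⟩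
    · exact congrArg Sum.inl (h2 t)
    · simp [SkTerm.map, Call.map, h2]

theorem skTerm_map_comp {F : Signature} {T : Type u} (f g : T → T) :
    (SkTerm.map f ∘ SkTerm.map g : SkTerm F T → SkTerm F T) = SkTerm.map (f ∘ g) := by
  ext (t | t) <;> rfl

theorem skTerm_map_id {F : Signature} {T : Type u} :
    (SkTerm.map id : SkTerm F T → SkTerm F T) = id := by
  ext (t | t) <;> rfl

/-- The missing inclusion is `map_doo_subset` for `π.symm`, pushed forward along `π`. -/
theorem doo_map {π : Equiv.Perm C} (hπ : ∀ c ∈ adom S.init, π c = c) (I : S.DB)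
    (α : S.Action) (σ : S.Params α) :
    S.doo (Database.map π I) α (π ∘ σ) = Database.map (SkTerm.map π) (S.doo I α σ) := by
  refine Set.Subset.antisymm ?_ (S.map_doo_subset hπ I α σ)
  have h := S.map_doo_subset (symm_fixes hπ) (Database.map π I) α (π ∘ σ)
  rw [Database.map_symm_map, ← Function.comp_assoc, Equiv.symm_comp_self,
    Function.id_comp] at h
  have h2 := Set.image_mono (f := Fact.map (SkTerm.map π)) h
  change Database.map _ (Database.map _ _) ⊆ _ at h2
  rwa [Database.map_map, skTerm_map_comp, Equiv.self_comp_symm, skTerm_map_id,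
    Database.map_id] at h2

/-- The value of a term under a function that evaluates all service calls. -/
abbrev value (τ : S.GCall → C) : SkTerm S.process.services C → C := Sum.elim id τ

variable {S}

/-- The type of an evaluation depends on `I`, `α` and `σ`. Writing it as the restriction of a
function on all calls turns the successor into a plain `Database.map` and allows transport between
different states. -/
theorem Eval.exists_extension [Nonempty C] {I : S.DB} {α : S.Action} {σ : S.Params α}
    (θ : S.Eval I α σ) : ∃ τ : S.GCall → C, θ = fun s => τ s.1 := by
  classical
  exact ⟨fun s => if h : s ∈ S.calls I α σ then θ ⟨s, h⟩ else Classical.arbitrary C,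
    funext fun s => by simp⟩

theorem termVal_restrict {I : S.DB} {α : S.Action} {σ : S.Params α} (τ : S.GCall → C)
    (t : SkTerm S.process.services C) (ht : ∀ s, t = Sum.inr s → s ∈ S.calls I α σ) :
    termVal (S := S) (fun s => τ s.1) t ht = S.value τ t := by
  cases t <;> rfl

theorem next_restrict {I : S.DB} {α : S.Action} {σ : S.Params α} (τ : S.GCall → C) :
    next (S := S) (I := I) (α := α) (σ := σ) (fun s => τ s.1) =
      Database.map (S.value τ) (S.doo I α σ) := by
  ext g
  constructor
  · rintro ⟨f, hf, rfl⟩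
    exact ⟨f, hf, congrArg (Fact.mk f.rel) (funext fun i => (termVal_restrict τ _ _).symm)⟩
  · rintro ⟨f, hf, rfl⟩
    exact ⟨f, hf, congrArg (Fact.mk f.rel) (funext fun i => (termVal_restrict τ _ _).symm)⟩

/-- Transport of the evaluation of service calls along a permutation. -/
def conj (π : Equiv.Perm C) (τ : S.GCall → C) : S.GCall → C :=
  fun s => π (τ (s.map π.symm))

theorem next_map {π : Equiv.Perm C} (hπ : ∀ c ∈ adom S.init, π c = c) {I : S.DB}
    {α : S.Action} {σ : S.Params α} (τ : S.GCall → C) :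
    next (S := S) (I := Database.map π I) (α := α) (σ := π ∘ σ) (fun s => conj π τ s.1) =
      Database.map π (next (S := S) (I := I) (α := α) (σ := σ) fun s => τ s.1) := by
  rw [next_restrict, next_restrict, S.doo_map hπ, Database.map_map, Database.map_map]
  congr 1
  ext (t | t)
  · rfl
  · simp [SkTerm.map, conj, Call.map]

theorem step_map [Nonempty C] {π : Equiv.Perm C} (hπ : ∀ c ∈ adom S.init, π c = c) {I J : S.DB}
    (h : S.Step I J) : S.Step (Database.map π I) (Database.map π J) := by
  obtain ⟨α, σ, θ, hl, rfl, hc⟩ := h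
  obtain ⟨τ, rfl⟩ := θ.exists_extension
  exact ⟨α, π ∘ σ, _, S.legal_map hπ hl, (next_map hπ τ).symm, S.conforms_map hπ hc⟩


/-! ### Commitments -/

/-- Parameters take values in `adom I` by legality, variables because answers do, and constants come
from `adom S.init`. -/
theorem adom_doo_subset {I : S.DB} {α : S.Action} {σ : S.Params α} (h : S.Legal I α σ) :
    adom (S.doo I α σ) ⊆ S.commitDomain I α σ := by
  intro t ht
  rcases t with c | s
  · left
    obtain ⟨_, ⟨e, _, θ, hθ, _, f, _, rfl⟩, i, hi⟩ := ht
    refine ⟨c, ?_, rfl⟩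
    change SkTerm.map _ (f.args i) = _ at hi
    generalize f.args i = t at hi
    rcases t with (a | p | x) | s
    · cases hi
      exact Or.inr a.2
    · cases hi
      exact Or.inl (h.mem_adom p)
    · cases hi
      exact Or.inl (hθ x)
    · cases hi
  · exact Or.inr ⟨s, ht, rfl⟩

/-- The number of service calls is bounded in terms of the size of the active domain. -/
theorem exists_calls_bound [Nonempty C] (S : DCDS C) (b : ℕ) :
    ∃ M : ℕ, ∀ (I : S.DB) (α : S.Action) (σ : S.Params α), (adom I).encard ≤ b →
      (S.calls I α σ).encard ≤ M := by
  have := S.process.finite_action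
  have hfin : ∀ (T : Type u) (l : List T), Finite {x // x ∈ l} := fun T l => l.finite_toSet
  -- A call is determined by an effect, an answer, a head fact and an argument position. Coding
  -- answers in `Fin (b + 1)` makes this index type independent of `I`; the extra element keeps the
  -- code type nonempty when `b = 0`.
  let X : S.Action → Type u := fun α => Σ e : {e // e ∈ S.process.effects α},
    (Fin e.1.nvars → Fin (b + 1)) × Σ f : {f // f ∈ e.1.head}, Fin (S.data.schema.arity f.1.rel)
  have hX : ∀ α, Finite (X α) := fun α => inferInstance
  refine ⟨Nat.card (Σ α, X α), fun I α σ hI => ?_⟩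
  have hI' : (adom I).Finite := Set.finite_of_encard_le_coe hI
  obtain ⟨f, _, hf⟩ := hI'.exists_injOn_of_encard_le (t := (Set.univ : Set (Fin (b + 1)))) <| by
    rw [Set.encard_univ, ENat.card_eq_coe_natCard, Nat.card_fin]
    exact hI.trans (by exact_mod_cast Nat.le_succ b)
  -- Decodes an index into the term it describes; codes outside the image of `f` get junk values,
  -- which is harmless for an upper bound.
  let F : X α → SkTerm S.process.services C := fun x =>
    SkTerm.map (Sum.elim Subtype.val (Sum.elim σ (Function.invFunOn f (adom I) ∘ x.2.1)))
      (x.2.2.1.1.args x.2.2.2)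
  have hF : Sum.inr '' S.calls I α σ ⊆ Set.range F := by
    rintro _ ⟨s, ⟨_, ⟨e, he, θ, hθ, _, g, hg, rfl⟩, i, hi⟩, rfl⟩
    refine ⟨⟨⟨e, he⟩, f ∘ θ, ⟨g, hg⟩, i⟩, ?_⟩
    have : Function.invFunOn f (adom I) ∘ f ∘ θ = θ :=
      funext fun x => hf.leftInvOn_invFunOn (hθ x)
    simp only [F, this]
    exact hi
  calc (S.calls I α σ).encard = (Sum.inr '' S.calls I α σ : Set (SkTerm _ C)).encard :=
        (Sum.inr_injective.encard_image _).symm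
    _ ≤ (Set.range F).encard := Set.encard_le_encard hF
    _ ≤ ENat.card (X α) := by
        rw [← Set.image_univ, ← Set.encard_univ]
        exact Set.encard_image_le _ _
    _ ≤ ENat.card (Σ α, X α) := ENat.card_le_card_of_injective (sigma_mk_injective (i := α))
    _ = _ := ENat.card_eq_coe_natCard _

theorem calls_finite [Nonempty C] {I : S.DB} (hI : (adom I).Finite) (α : S.Action)
    (σ : S.Params α) : (S.calls I α σ).Finite := by
  obtain ⟨b, hb⟩ := hI.exists_encard_eq_coe
  obtain ⟨M, hM⟩ := S.exists_calls_bound b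
  exact Set.finite_of_encard_le_coe (hM I α σ hb.le)

theorem adom_init_finite (S : DCDS C) : (adom S.init).Finite := adom_finite S.data.finite_init

theorem commitDomain_finite [Nonempty C] {I : S.DB} (hI : (adom I).Finite) (α : S.Action)
    (σ : S.Params α) : (S.commitDomain I α σ).Finite := by
  refine (((hI.union S.adom_init_finite).image Sum.inl).union
    ((calls_finite hI α σ).image Sum.inr)).subset ?_
  rintro t (⟨c, hc, rfl⟩ | ⟨s, hs, rfl⟩)
  · exact Or.inl ⟨c, hc, rfl⟩
  · exact Or.inr ⟨s, hs, rfl⟩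

theorem StateBounded.adom_finite (hS : S.StateBounded) {I : S.DB} (hI : I ∈ S.concreteStates) :
    (adom I).Finite := by
  obtain ⟨b, hb⟩ := hS
  exact Set.finite_of_encard_le_coe (hb I hI).le

theorem next_eq_map_next {I : S.DB} {α : S.Action} {σ : S.Params α} (hl : S.Legal I α σ)
    {ρ : C → C} {τ τ' : S.GCall → C}
    (h : ∀ t ∈ S.commitDomain I α σ, ρ (S.value τ t) = S.value τ' t) :
    next (S := S) (I := I) (α := α) (σ := σ) (fun s => τ' s.1) =
      Database.map ρ (next (S := S) (I := I) (α := α) (σ := σ) fun s => τ s.1) := by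
  rw [next_restrict, next_restrict, Database.map_map]
  exact Database.map_congr fun t ht => (h t (adom_doo_subset hl ht)).symm

theorem respects_restrict_iff {I : S.DB} {α : S.Action} {σ : S.Params α}
    {H : S.Commitment I α σ} {τ : S.GCall → C} :
    Respects (S := S) (fun s => τ s.1) H ↔
      ∀ t t' : S.commitDomain I α σ, H.rel t t' ↔ S.value τ t = S.value τ t' := by
  simp only [Respects, termVal_restrict]

/-- The commitment that an evaluation respects. -/
def Commitment.ofEval {I : S.DB} {α : S.Action} {σ : S.Params α} (θ : S.Eval I α σ) :
    S.Commitment I α σ where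
  rel := Setoid.ker fun t : S.commitDomain I α σ =>
    termVal θ t.1 (mem_calls_of_mem_commitDomain t.2)
  const_eq := by
    rintro ⟨_, ht⟩ ⟨_, ht'⟩ c c' rfl rfl h
    exact h

theorem respects_ofEval {I : S.DB} {α : S.Action} {σ : S.Params α} (θ : S.Eval I α σ) :
    Respects θ (.ofEval θ) :=
  fun _ _ => Iff.rfl

/-- The successors via evaluations that respect the same commitment are isomorphic. -/
theorem exists_perm_next [Nonempty C] {I : S.DB} {α : S.Action} {σ : S.Params α}
    (hI : (adom I).Finite) (hl : S.Legal I α σ) {H : S.Commitment I α σ} {θ θ' : S.Eval I α σ}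
    (h : Respects θ H) (h' : Respects θ' H) :
    ∃ ρ : Equiv.Perm C, (∀ c ∈ adom I ∪ adom S.init, ρ c = c) ∧
      next θ' = Database.map ρ (next θ) := by
  obtain ⟨τ, rfl⟩ := θ.exists_extension
  obtain ⟨τ', rfl⟩ := θ'.exists_extension
  rw [respects_restrict_iff] at h h'
  have := (commitDomain_finite hI α σ).to_subtype
  -- Both evaluations have the equality pattern `H`. Since values belong to the commitment domain
  -- and evaluate to themselves, `ρ` fixes them.
  obtain ⟨ρ, hρ⟩ := exists_perm_of_injective_pattern
    (fun t : S.commitDomain I α σ => S.value τ t) (fun t => S.value τ' t)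
    fun t t' => (h t t').symm.trans (h' t t')
  exact ⟨ρ, fun c hc => hρ ⟨.inl c, .inl ⟨c, hc, rfl⟩⟩,
    next_eq_map_next hl fun t ht => hρ ⟨t, ht⟩⟩

/-- Every commitment is represented by an evaluation with values in any sufficiently large set
of values, besides those of the current and the initial state. -/
theorem exists_mem_evals_mem_loopEvals [Nonempty C] {I : S.DB} {α : S.Action} {σ : S.Params α}
    (hI : (adom I).Finite) (hl : S.Legal I α σ) {H : S.Commitment I α σ} {V : Set C}
    (hV : V.encard = (S.calls I α σ).encard) (hd : Disjoint V (adom S.init ∪ adom I))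
    (hH : (S.evals I α σ H).Nonempty) :
    ∃ θ ∈ S.evals I α σ H, θ ∈ S.loopEvals I α σ V := by
  classical
  obtain ⟨θ, hθ, hc⟩ := hH
  obtain ⟨τ, rfl⟩ := θ.exists_extension
  set F := adom S.init ∪ adom I with hF
  have hFfin : F.Finite := S.adom_init_finite.union hI
  have hWfin : (τ '' S.calls I α σ \ F).Finite := ((calls_finite hI α σ).image τ).sdiff
  -- The values of `τ` outside `F` are at most as many as the calls, so they can be renamed
  -- injectively into `V`.
  obtain ⟨g, hgV, hg⟩ := hWfin.exists_injOn_of_encard_le (t := V) <| by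
    rw [hV]
    exact (Set.encard_le_encard Set.sdiff_subset).trans (Set.encard_image_le _ _)
  -- Keeping `F` fixed and renaming the rest into `V` creates no new equalities, because `V` is
  -- disjoint from `F`.
  have hinj : Set.InjOn (fun a => if a ∈ F then a else g a) (F ∪ (τ '' S.calls I α σ \ F)) := by
    have hW : ∀ a ∈ F ∪ (τ '' S.calls I α σ \ F), a ∉ F → a ∈ τ '' S.calls I α σ \ F :=
      fun a ha haF => ha.resolve_left haF
    intro a ha b hb hab
    by_cases haF : a ∈ F <;> by_cases hbF : b ∈ F <;> simp only [haF, hbF, if_true, if_false] at hab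
    · exact hab
    · exact absurd (hab ▸ haF) (hd.notMem_of_mem_left (hgV (hW b hb hbF)))
    · exact absurd (hab ▸ hbF) (hd.notMem_of_mem_left (hgV (hW a ha haF)))
    · exact hg (hW a ha haF) (hW b hb hbF) hab
  obtain ⟨ρ, hρ⟩ := hinj.exists_perm (hFfin.union hWfin)
  have hρF : ∀ c ∈ F, ρ c = c := fun c hc => (hρ c (Or.inl hc)).trans (if_pos hc)
  have hval : ∀ t ∈ S.commitDomain I α σ, ρ (S.value τ t) = S.value (ρ ∘ τ) t := by
    rintro t (⟨c, hc, rfl⟩ | ⟨s, hs, rfl⟩)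
    · exact hρF c hc.symm
    · rfl
  have hconf : S.Conforms (next (S := S) (I := I) (α := α) (σ := σ) fun s => (ρ ∘ τ) s.1) := by
    rw [next_eq_map_next hl hval]
    exact S.conforms_map (fun c hc => hρF c (Or.inl hc)) hc
  refine ⟨fun s => (ρ ∘ τ) s.1, ⟨?_, hconf⟩, fun s => ?_, hconf⟩
  · rw [respects_restrict_iff] at hθ ⊢
    intro t t'
    rw [hθ, ← hval _ t.2, ← hval _ t'.2, ρ.injective.eq_iff]
  · by_cases hs : τ s ∈ F
    · left
      change ρ (τ s) ∈ F
      rwa [hρF _ hs]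
    · right
      change ρ (τ s) ∈ V
      rw [hρ _ (Or.inr ⟨⟨s, s.2, rfl⟩, hs⟩), if_neg hs]
      exact hgV ⟨⟨s, s.2, rfl⟩, hs⟩

/-! ### Prunings are bisimilar to the concrete transition system -/

theorem IsPruning.persistenceBisimilar [Nonempty C] (hS : S.StateBounded) {Sta : Set S.DB}
    {tr : Set (S.DB × S.DB)} (hP : S.IsPruning Sta tr) :
    PersistenceBisimilar (adom S.init) S.concreteTS (S.mkTS Sta hP.init_mem tr) := by
  refine ⟨fun s₁ h s₂ => ∃ π : Equiv.Perm C, (∀ c ∈ adom S.init, π c = c) ∧ h = π.toPEquiv ∧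
    s₂.1 = Database.map π s₁.1, ?_, (Equiv.refl C).toPEquiv, Equiv.refl C, fun _ _ => rfl, rfl,
    (Database.map_id _).symm⟩
  rintro ⟨I, hI⟩ _ ⟨J, hJ⟩ ⟨π, hπ, rfl, rfl : J = Database.map π I⟩
  refine ⟨fun c hc => congrArg some (hπ c hc), isIso_map π I, ?_, ?_⟩
  · rintro ⟨I', hI'⟩ hstep
    obtain ⟨α, σ, θ, hl, rfl, hc⟩ : S.Step I I' := hstep
    obtain ⟨τ, rfl⟩ := θ.exists_extension
    have hc' := S.conforms_map hπ hc
    rw [← next_map hπ] at hc'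
    have hl' := S.legal_map hπ hl
    -- The transported step is a concrete step from `J`, but need not be in the pruning; a step with
    -- the same commitment is. The correction `ρ` between the two fixes `adom J`, so composing with
    -- it does not disturb persisting values.
    obtain ⟨θ', ⟨hr, hc''⟩, htr⟩ := hP.represented _ hJ α _ hl' _ ⟨_, respects_ofEval _, hc'⟩
    obtain ⟨ρ, hρ, hnext⟩ := exists_perm_next (hS.adom_finite (hP.states_subset hJ)) hl'
      (respects_ofEval _) hr
    rw [next_map hπ, Database.map_map] at hnext
    refine ⟨⟨next θ', (hP.trans_subset _ _ htr).2.1⟩, (π.trans ρ).toPEquiv, htr,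
      ⟨fun a ha => ?_, fun b hb => ?_⟩, π.trans ρ, fun c hc => ?_, rfl, hnext⟩
    · refine congrArg some (hρ _ (Or.inl ?_))
      rw [adom_map]
      exact ⟨a, ha.1, rfl⟩
    · refine congrArg (fun c => some (π.symm c)) ((Equiv.symm_apply_eq ρ).2 ?_)
      exact (hρ _ (Or.inl hb.1)).symm
    · exact (congrArg ρ (hπ c hc)).trans (hρ c (Or.inr hc))
  · rintro ⟨J', hJ'⟩ (htr : (_, J') ∈ tr)
    -- In this direction no correction is needed: the concrete system is closed under permutations
    -- fixing the constants, so `π` itself still serves.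
    have hstep := step_map (symm_fixes hπ) (hP.trans_subset _ _ htr).2.2
    rw [Database.map_symm_map] at hstep
    exact ⟨⟨Database.map π.symm J', hI.tail hstep⟩, π.toPEquiv, hstep,
      ⟨fun _ _ => rfl, fun _ _ => rfl⟩, π, hπ, rfl, (Database.map_map_symm π J').symm⟩

/-! ### Invariants of the algorithm -/

/-- This closed form shows that the order of the inner loop is irrelevant. -/
theorem foldl_record {β : Type v} (I : S.DB) (f : β → S.DB) (L : List β) (c : S.Config) :
    L.foldl (fun d x => d.record I (f x)) c =
      ⟨c.states ∪ f '' {x | x ∈ L}, c.trans ∪ (fun x => (I, f x)) '' {x | x ∈ L},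
        c.used ∪ ⋃ x ∈ L, adom (f x), c.visited⟩ := by
  induction L generalizing c with
  | nil => simp
  | cons a L ih =>
    have h : {x | x ∈ a :: L} = insert a {x | x ∈ L} := by
      ext; simp
    rw [List.foldl_cons, ih, h, Set.image_insert_eq, Set.image_insert_eq]
    simp only [Config.record, Config.mk.injEq, List.mem_cons, Set.iUnion_iUnion_eq_or_left,
      Set.union_assoc, and_true]
    constructor <;> rw [Set.insert_union, Set.union_insert]

/-- What holds after any number of iterations; `U` bounds the number of used values. -/
structure Config.Invariant (c : S.Config) (U : ℕ) : Prop where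
  states_finite : c.states.Finite
  trans_finite : c.trans.Finite
  init_mem : S.init ∈ c.states
  states_subset : c.states ⊆ S.concreteStates
  trans_subset : ∀ I J, (I, J) ∈ c.trans → I ∈ c.states ∧ J ∈ c.states ∧ S.Step I J
  adom_subset_used : ∀ I ∈ c.states, adom I ⊆ c.used
  used_le : c.used.encard ≤ U
  visited : ∀ I α σ, (I, ⟨α, σ⟩) ∈ c.visited → I ∈ c.states ∧ S.Legal I α σ ∧
    ∃ V : Set C, V.encard = (S.calls I α σ).encard ∧ Disjoint V (adom S.init ∪ adom I) ∧
      ∀ θ ∈ S.loopEvals I α σ V, (I, next θ) ∈ c.trans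

theorem Config.Invariant.used_finite {c : S.Config} {U : ℕ} (h : c.Invariant U) : c.used.Finite :=
  Set.finite_of_encard_le_coe h.used_le

theorem adom_next_subset [Nonempty C] {I : S.DB} {α : S.Action} {σ : S.Params α}
    (hl : S.Legal I α σ) {V : Set C} {θ : S.Eval I α σ} (hθ : θ ∈ S.loopEvals I α σ V) :
    adom (next θ) ⊆ adom S.init ∪ adom I ∪ V := by
  obtain ⟨τ, rfl⟩ := θ.exists_extension
  rw [next_restrict, adom_map]
  rintro _ ⟨t, ht, rfl⟩
  obtain ⟨c, hc, rfl⟩ | ⟨s, hs, rfl⟩ := adom_doo_subset hl ht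
  · exact Or.inl hc.symm
  · exact hθ.1 ⟨s, hs⟩

theorem loopEvals_finite [Nonempty C] {I : S.DB} (hI : (adom I).Finite) (α : S.Action)
    (σ : S.Params α) {V : Set C} (hV : V.Finite) : (S.loopEvals I α σ V).Finite := by
  have := (calls_finite hI α σ).to_subtype
  exact (Set.Finite.pi' fun _ => (S.adom_init_finite.union hI).union hV).subset fun θ hθ => hθ.1

theorem Admissible.finite [Nonempty C] {c : S.Config} {I : S.DB} {α : S.Action} {σ : S.Params α}
    {V : Set C} (hV : Admissible c I α σ V) (hI : (adom I).Finite) : V.Finite := by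
  rw [← Set.encard_ne_top_iff, hV.1, Set.encard_ne_top_iff]
  exact calls_finite hI α σ

/-- Recyclable values avoid both domains by definition; fresh values do because both domains consist
of used values. -/
theorem Admissible.disjoint {c : S.Config} {U : ℕ} (hc : c.Invariant U) {I : S.DB}
    (hI : I ∈ c.states) {α : S.Action} {σ : S.Params α} {V : Set C}
    (hV : Admissible c I α σ V) : Disjoint V (adom S.init ∪ adom I) := by
  have h := hV.2
  split_ifs at h
  · exact Set.disjoint_left.2 fun x hx => (h hx).2
  · refine Set.disjoint_left.2 fun x hx hx' => h hx ?_
    exact hx'.elim (fun hx' => hc.adom_subset_used _ hc.init_mem hx')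
      fun hx' => hc.adom_subset_used _ hI hx'

theorem exists_admissible [Infinite C] {c : S.Config} {U : ℕ} (hc : c.Invariant U) (I : S.DB)
    (α : S.Action) (σ : S.Params α) : ∃ V, Admissible c I α σ V := by
  by_cases h : (S.calls I α σ).encard ≤ (recyclable c I).encard
  · obtain ⟨V, hV, hcard⟩ := Set.exists_subset_encard_eq h
    exact ⟨V, hcard, by rwa [if_pos h]⟩
  · have h' : (S.calls I α σ).encard ≤ c.usedᶜ.encard := by
      rw [hc.used_finite.infinite_compl.encard_eq]
      exact le_top
    obtain ⟨V, hV, hcard⟩ := Set.exists_subset_encard_eq h'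
    exact ⟨V, hcard, by rwa [if_neg h]⟩

theorem exists_iteration [Infinite C] {c : S.Config} {U : ℕ} (hc : c.Invariant U) {I : S.DB}
    {α : S.Action} {σ : S.Params α} (h : Pickable c I α σ) : ∃ c', S.Iteration c c' := by
  obtain ⟨V, hV⟩ := exists_admissible hc I α σ
  have hI : (adom I).Finite := hc.used_finite.subset (hc.adom_subset_used I h.1)
  have hfin := loopEvals_finite hI α σ (hV.finite hI)
  exact ⟨_, I, α, σ, V, hfin.toFinset.toList, h, hV, Finset.nodup_toList _, by simp, rfl⟩

theorem exists_invariant [Nonempty C] (hS : S.StateBounded) :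
    ∃ U : ℕ, S.initConfig.Invariant U ∧
      ∀ c c' : S.Config, c.Invariant U → S.Iteration c c' → c'.Invariant U := by
  obtain ⟨b, hb⟩ := hS
  obtain ⟨M, hM⟩ := S.exists_calls_bound b
  obtain ⟨a, ha⟩ := S.adom_init_finite.exists_encard_eq_coe
  -- When fresh values are taken, at most `M` used values are recyclable, at most `a + b` lie in the
  -- initial or current database, and at most `M` are added.
  refine ⟨M + (a + b) + M, ?_, ?_⟩
  · refine ⟨Set.finite_singleton _, Set.finite_empty, rfl, ?_, fun _ _ h => h.elim, ?_, ?_,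
      fun _ _ _ h => h.elim⟩
    · rintro _ rfl
      exact Relation.ReflTransGen.refl
    · rintro _ rfl
      exact subset_rfl
    · change (adom S.init).encard ≤ _
      rw [ha]
      exact_mod_cast (by omega)
  · rintro c _ hc ⟨I, α, σ, V, L, hp, hV, -, hL, rfl⟩
    rw [foldl_record]
    have hIb := (hb I (hc.states_subset hp.1)).le
    have hstep : ∀ θ ∈ L, S.Step I (next θ) := fun θ hθ =>
      ⟨α, σ, θ, hp.2.1, rfl, ((hL θ).1 hθ).2⟩
    have hadom : ∀ θ ∈ L, adom (next θ) ⊆ c.used ∪ V := fun θ hθ =>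
      (adom_next_subset hp.2.1 ((hL θ).1 hθ)).trans <| Set.union_subset_union_left _ <|
        Set.union_subset (hc.adom_subset_used _ hc.init_mem) (hc.adom_subset_used _ hp.1)
    have hLfin : {θ | θ ∈ L}.Finite := L.finite_toSet
    refine ⟨hc.states_finite.union (hLfin.image _), hc.trans_finite.union (hLfin.image _),
      Or.inl hc.init_mem, ?_, ?_, ?_, ?_, ?_⟩
    · rintro J (hJ | ⟨θ, hθ, rfl⟩)
      · exact hc.states_subset hJ
      · exact (hc.states_subset hp.1).tail (hstep θ hθ)
    · rintro J J' (hJ | ⟨θ, hθ, h⟩)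
      · obtain ⟨h1, h2, h3⟩ := hc.trans_subset J J' hJ
        exact ⟨Or.inl h1, Or.inl h2, h3⟩
      · cases h
        exact ⟨Or.inl hp.1, Or.inr ⟨θ, hθ, rfl⟩, hstep θ hθ⟩
    · rintro J (hJ | ⟨θ, hθ, rfl⟩)
      · exact (hc.adom_subset_used J hJ).trans Set.subset_union_left
      · exact (Set.subset_biUnion_of_mem (u := fun θ => adom (next θ)) hθ).trans
          Set.subset_union_right
    · have hused : c.used ∪ ⋃ θ ∈ L, adom (next θ) ⊆ c.used ∪ V :=
        Set.union_subset Set.subset_union_left (Set.iUnion₂_subset hadom)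
      refine (Set.encard_le_encard hused).trans ?_
      have h := hV.2
      split_ifs at h with hn
      -- With recycling, `V` consists of used values and nothing is added.
      · rw [Set.union_eq_left.2 (h.trans Set.sdiff_subset)]
        exact hc.used_le
      · have h1 : c.used ⊆ recyclable c I ∪ (adom S.init ∪ adom I) := by
          rw [recyclable, Set.sdiff_union_self]
          exact Set.subset_union_left
        have h2 : (recyclable c I).encard ≤ M := (not_le.1 hn).le.trans (hM I α σ hIb)
        calc (c.used ∪ V).encard ≤ c.used.encard + V.encard := Set.encard_union_le _ _
          _ ≤ ((recyclable c I).encard + ((adom S.init).encard + (adom I).encard)) + V.encard := by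
            gcongr
            refine (Set.encard_le_encard h1).trans ((Set.encard_union_le _ _).trans ?_)
            gcongr
            exact Set.encard_union_le _ _
          _ ≤ (M + (a + b)) + M := by
            rw [ha, hV.1]
            gcongr
            exact hM I α σ hIb
          _ = _ := by push_cast; rfl
    · rintro J β ψ (h | h)
      · cases h
        exact ⟨Or.inl hp.1, hp.2.1, V, hV.1, hV.disjoint hc hp.1,
          fun θ hθ => Or.inr ⟨θ, (hL θ).2 hθ, rfl⟩⟩
      · obtain ⟨h1, h2, W, h3, h4, h5⟩ := hc.visited J β ψ h
        exact ⟨Or.inl h1, h2, W, h3, h4, fun θ hθ => Or.inl (h5 θ hθ)⟩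

theorem Iteration.used_subset {c c' : S.Config} (h : S.Iteration c c') : c.used ⊆ c'.used := by
  obtain ⟨I, α, σ, V, L, -, -, -, -, rfl⟩ := h
  rw [foldl_record]
  exact Set.subset_union_left

theorem Iteration.visited_ssubset {c c' : S.Config} (h : S.Iteration c c') :
    c.visited ⊂ c'.visited := by
  obtain ⟨I, α, σ, V, L, hp, -, -, -, rfl⟩ := h
  rw [foldl_record]
  exact Set.ssubset_insert hp.2.2

/-! ### Termination -/

/-- Otherwise `U + 1` elements of the union would, by monotonicity, already lie in a single `f k`.
-/
theorem _root_.Set.finite_iUnion_of_monotone_of_encard_le {T : Type u} {f : ℕ → Set T}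
    (hf : Monotone f) {U : ℕ} (hU : ∀ k, (f k).encard ≤ U) : (⋃ k, f k).Finite := by
  by_contra h
  obtain ⟨t, ht, hcard⟩ := Set.Infinite.exists_subset_card_eq h (U + 1)
  obtain ⟨k, hk⟩ := Directed.exists_mem_subset_of_finset_subset_biUnion hf.directed_le ht
  have := (Set.encard_le_encard hk).trans (hU k)
  rw [Set.encard_coe_eq_coe_finsetCard, hcard, Nat.cast_le] at this
  omega

theorem Config.Invariant.visited_subset {c : S.Config} {U : ℕ} (h : c.Invariant U) {D : Set C}
    (hD : c.used ⊆ D) :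
    c.visited ⊆ {I | adom I ⊆ D} ×ˢ ⋃ α, Sigma.mk α '' {σ : S.Params α | ∀ i, σ i ∈ D} := by
  rintro ⟨I, α, σ⟩ hv
  obtain ⟨hI, hl, -⟩ := h.visited I α σ hv
  have hID := (h.adom_subset_used I hI).trans hD
  exact ⟨hID, Set.mem_iUnion.2 ⟨α, σ, fun i => hID (hl.mem_adom i), rfl⟩⟩

/-- From no configuration that satisfies the invariant there are infinitely many iterations. -/
theorem not_exists_infinite_run {U : ℕ}
    (hU : ∀ c c' : S.Config, c.Invariant U → S.Iteration c c' → c'.Invariant U)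
    (run : ℕ → S.Config) (h0 : (run 0).Invariant U) :
    ¬ ∀ k, S.Iteration (run k) (run (k + 1)) := by
  intro hrun
  have hinv : ∀ k, (run k).Invariant U := fun k => by
    induction k with
    | zero => exact h0
    | succ k ih => exact hU _ _ ih (hrun k)
  have hD : (⋃ k, (run k).used).Finite :=
    Set.finite_iUnion_of_monotone_of_encard_le
      (monotone_nat_of_le_succ fun k => (hrun k).used_subset) fun k => (hinv k).used_le
  have := S.process.finite_action
  have hfin := (finite_databases S.data.schema hD).prod
    (Set.finite_iUnion fun α : S.Action =>
      (Set.Finite.pi' fun _ : Fin (S.process.nparams α) => hD).image (Sigma.mk α))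
  -- The visited sets would form an infinite strictly increasing chain of subsets of one finite set.
  have hmono : StrictMono fun k => (run k).visited :=
    strictMono_nat_of_lt_succ fun k => (hrun k).visited_ssubset
  refine Set.infinite_range_of_injective hmono.injective (hfin.finite_subsets.subset ?_)
  rintro _ ⟨k, rfl⟩
  exact (hinv k).visited_subset (Set.subset_iUnion (fun k => (run k).used) k)

theorem Config.Invariant.of_reflTransGen {U : ℕ}
    (hU : ∀ c c' : S.Config, c.Invariant U → S.Iteration c c' → c'.Invariant U)
    {c c' : S.Config} (hc : c.Invariant U) (h : Relation.ReflTransGen S.Iteration c c') :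
    c'.Invariant U := by
  induction h with
  | refl => exact hc
  | tail _ h ih => exact hU _ _ ih h

/-- The algorithm can be run until no triple can be picked. -/
theorem exists_not_pickable [Infinite C] {U : ℕ}
    (hU : ∀ c c' : S.Config, c.Invariant U → S.Iteration c c' → c'.Invariant U)
    {c : S.Config} (hc : c.Invariant U) :
    ∃ c', Relation.ReflTransGen S.Iteration c c' ∧ ∀ I α σ, ¬ Pickable c' I α σ := by
  by_contra! h
  have hnext : ∀ d : {d // Relation.ReflTransGen S.Iteration c d},
      ∃ d' : {d // Relation.ReflTransGen S.Iteration c d}, S.Iteration d.1 d'.1 := by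
    rintro ⟨d, hd⟩
    obtain ⟨I, α, σ, hp⟩ := h d hd
    obtain ⟨d', hd'⟩ := exists_iteration (hc.of_reflTransGen hU hd) hp
    exact ⟨⟨d', hd.tail hd'⟩, hd'⟩
  choose f hf using hnext
  refine not_exists_infinite_run hU (fun k => (f^[k] ⟨c, .refl⟩).1) hc fun k => ?_
  rw [Function.iterate_succ_apply']
  exact hf _

/-! ### The output -/

theorem Config.Invariant.isPruning [Nonempty C] {c : S.Config} {U : ℕ} (hc : c.Invariant U)
    (hp : ∀ I α σ, ¬ Pickable c I α σ) : S.IsPruning c.states c.trans where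
  init_mem := hc.init_mem
  states_subset := hc.states_subset
  trans_subset := hc.trans_subset
  represented I hI α σ hl H hH := by
    have hv : (I, ⟨α, σ⟩) ∈ c.visited := by
      by_contra hv
      exact hp I α σ ⟨hI, hl, hv⟩
    obtain ⟨-, -, V, hV, hd, htr⟩ := hc.visited I α σ hv
    obtain ⟨θ, hθ, hθV⟩ := exists_mem_evals_mem_loopEvals
      (hc.used_finite.subset (hc.adom_subset_used I hI)) hl hV hd hH
    exact ⟨θ, hθ, htr θ hθV⟩
  finite_branching I _ := hc.trans_finite.preimage (Prod.mk_right_injective I).injOn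

theorem apply_mem_adom_next {I : S.DB} {α : S.Action} {σ : S.Params α} (θ : S.Eval I α σ)
    (s : S.calls I α σ) : θ s ∈ adom (next θ) := by
  obtain ⟨s, f, hf, i, hi⟩ := s
  refine ⟨_, ⟨f, hf, rfl⟩, i, ?_⟩
  have : ∀ (t : SkTerm S.process.services C) (ht : ∀ s, t = Sum.inr s → s ∈ S.calls I α σ)
      (h : t = Sum.inr s), termVal θ t ht = θ ⟨s, ht s h⟩ := by
    rintro _ ht rfl
    rfl
  exact this _ _ hi

/-- Only finitely many values occur on the paths, so that only finitely many steps introduce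
values that have not occurred before. -/
theorem eventuallyRecycling_of_finite [Nonempty C] {tr : Set (S.DB × S.DB)} {A : Set C} (hA : A.Finite)
    (h : ∀ I J, (I, J) ∈ tr → adom J ⊆ A) : S.EventuallyRecycling tr := by
  intro s α σ θ hs
  have hmem : ∀ k c, θ k c ∈ adom (s (k + 1)) := fun k c => by
    rw [(hs k).2.2.1]
    exact apply_mem_adom_next _ c
  have hex : ∀ k ∈ {k | ¬ ∀ c, θ k c ∈ ⋃ j ≤ k, adom (s j)},
      ∃ v ∈ adom (s (k + 1)), v ∉ ⋃ j ≤ k, adom (s j) := by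
    intro k hk
    obtain ⟨c, hc⟩ := not_forall.1 hk
    exact ⟨_, hmem k c, hc⟩
  choose! v hv hv' using hex
  -- For `k < l` the value `v k` occurs in state `k + 1 ≤ l`, whereas `v l` occurs in no state up to
  -- `l`. So `v` is injective on the non-recycling steps.
  have hne : ∀ k ∈ {k | ¬ ∀ c, θ k c ∈ ⋃ j ≤ k, adom (s j)},
      ∀ l ∈ {k | ¬ ∀ c, θ k c ∈ ⋃ j ≤ k, adom (s j)}, k < l → v k ≠ v l := by
    intro k hk l hl hkl heq
    exact hv' l hl (heq ▸ Set.mem_biUnion (Nat.succ_le_of_lt hkl) (hv k hk))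
  refine Set.Finite.of_finite_image (f := v) (hA.subset ?_) fun k hk l hl hkl => ?_
  · rintro _ ⟨k, hk, rfl⟩
    exact h _ _ (hs k).1 (hv k hk)
  · rcases lt_trichotomy k l with hlt | heq | hlt
    · exact absurd hkl (hne k hk l hl hlt)
    · exact heq
    · exact absurd hkl.symm (hne l hl k hk hlt)

end DCDS
end Dcds

/-! ### The main theorem -/

theorem mainTheorem4 {C : Type u} [Countable C] [Infinite C] (S : Dcds.DCDS C)
    (hS : S.StateBounded) :
    -- no run performs infinitely many iterations
    (¬ ∃ run : ℕ → S.Config, run 0 = S.initConfig ∧ ∀ k, S.Iteration (run k) (run (k + 1))) ∧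
    ∀ c : S.Config, S.Reached c →
      -- every single iteration can be carried out, and is finite whatever is picked
      (∀ I α σ, Dcds.DCDS.Pickable c I α σ →
        (∃ V, Dcds.DCDS.Admissible c I α σ V) ∧
        ∀ V, Dcds.DCDS.Admissible c I α σ V → (S.loopEvals I α σ V).Finite) ∧
      -- the output is as required
      (S.Saturated c →
        c.states.Finite ∧ c.trans.Finite ∧ S.EventuallyRecycling c.trans ∧
        ∃ hP : S.IsPruning c.states c.trans,
          Dcds.PersistenceBisimilar (Dcds.adom S.init) S.concreteTS
            (S.mkTS c.states hP.init_mem c.trans)) := by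
  obtain ⟨U, h0, hU⟩ := Dcds.DCDS.exists_invariant hS
  refine ⟨fun ⟨run, hrun0, hrun⟩ =>
    Dcds.DCDS.not_exists_infinite_run hU run (hrun0 ▸ h0) hrun, fun c hreach => ?_⟩
  have hc : c.Invariant U := h0.of_reflTransGen hU hreach
  refine ⟨fun I α σ hp => ⟨Dcds.DCDS.exists_admissible hc I α σ, fun V hV => ?_⟩, fun hsat => ?_⟩
  · have hI := hS.adom_finite (hc.states_subset hp.1)
    exact Dcds.DCDS.loopEvals_finite hI α σ (hV.finite hI)
  -- In a saturated configuration some triples may still be pickable. Continuing until none is left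
  -- changes neither states nor transitions, so the pruning property of `c'` is one of `c`.
  · obtain ⟨c', hcc', hp⟩ := Dcds.DCDS.exists_not_pickable hU hc
    obtain ⟨hs, ht⟩ := hsat c' hcc'
    have hP := (hc.of_reflTransGen hU hcc').isPruning hp
    rw [hs, ht] at hP
    exact ⟨hc.states_finite, hc.trans_finite,
      Dcds.DCDS.eventuallyRecycling_of_finite hc.used_finite fun I J hIJ =>
        hc.adom_subset_used J (hc.trans_subset I J hIJ).2.1,
      hP, hP.persistenceBisimilar hS⟩
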